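/- Hall's universal locally finite group is a countable group $U$ such that every finitely generated subgroup of $U$ is finite, every finite group embeds into $U$, and for any two injective homomorphisms $f, g \colon G \to U$ from a finite group $G$ there is $s \in U$ with $g(x) = s f(x) s^{-1}$ for all $x \in G$. For a group $\Gamma$ we use the following notions. - $\Gamma$ is *binate* if for every finitely generated subgroup $H \leq \Gamma$ there exist a homomorphism $f \colon H \to \Gamma$ such that every element of $H$ commutes with every element of $f(H)$, and an element $t \in \Gamma$ such that $t f(h) t^{-1} = h f(h)$ for all $h \in H$. - $\Gamma$ *has commuting conjugates* if for every finitely generated subgroup $H \leq \Gamma$ there exists $t \in \Gamma$ such that every element of $H$ commutes with every element of $t H t^{-1}$. - $\Gamma$ is *dissipated* if it is isomorphic to a group $\Gamma'$ of bijections of a set $X$ for which there is a family $(X_i)_{i \in I}$ of subsets of $X$, directed under inclusion and with union $X$, such that every $g \in \Gamma'$ satisfies $\{x : g(x) \neq x\} \subseteq X_i$ for some $i \in I$, and such that for every $i \in I$ there exists $t_i \in \Gamma'$ with the following two properties: $t_i^p(X_i) \cap X_i = \varnothing$ for all integers $p \geq 1$; and for every $g \in \Gamma'$ with $\{x : g(x)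 \neq x\} \subseteq X_i$, the bijection of $X$ that equals $t_i^p g t_i^{-p}$ on $t_i^p(X_i)$ for every $p \geq 1$ and is the identity elsewhere belongs to $\Gamma'$. **Statement.** A group $U$ as above exists, and every such group $U$ is binate and has commuting conjugates, but is not dissipated. In particular, there is a binate group with commuting conjugates that is not dissipated. -/

import Mathlib

universe u v w

/-- A group is locally finite if all its finitely generated subgroups are finite. -/
def IsLocallyFiniteGroup (Γ : Type u) [Group Γ] : Prop :=
  ∀ H : Subgroup Γ, H.FG → Finite H

/-- `U` is (a copy of) Hall's universal locally finite group: a countable locally finite group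
in which every finite group embeds, the embedding being unique up to conjugacy in `U`. -/
structure IsHallUniversal (U : Type u) [Group U] : Prop where
  countable : Countable U
  locallyFinite : IsLocallyFiniteGroup U
  exists_embedding : ∀ (G : Type u) [Group G] [Finite G],
    ∃ f : G →* U, Function.Injective f
  embedding_unique : ∀ (G : Type u) [Group G] [Finite G] (f g : G →* U),
    Function.Injective f → Function.Injective g → ∃ s : U, ∀ x : G, g x = s * f x * s⁻¹

/-- Binate groups: for every finitely generated subgroup `H` there are a homomorphism
`f : H → Γ` with `[H, f(H)] = 1` and `t ∈ Γ` with `t f(h) t⁻¹ = h f(h)` for all `h ∈ H`. -/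
def IsBinate (Γ : Type u) [Group Γ] : Prop :=
  ∀ H : Subgroup Γ, H.FG → ∃ f : H →* Γ,
    (∀ h k : H, Commute (h : Γ) (f k)) ∧ ∃ t : Γ, ∀ h : H, t * f h * t⁻¹ = (h : Γ) * f h

/-- Commuting conjugates: for every finitely generated subgroup `H` there is `t ∈ Γ` with
`[H, t H t⁻¹] = 1`. -/
def HasCommutingConjugates (Γ : Type u) [Group Γ] : Prop :=
  ∀ H : Subgroup Γ, H.FG → ∃ t : Γ, ∀ h ∈ H, ∀ k ∈ H, Commute h (t * k * t⁻¹)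

/-- The permutation `g` is supported on the set `B`. -/
def SupportedOn {X : Type v} (g : Equiv.Perm X) (B : Set X) : Prop :=
  {x | g x ≠ x} ⊆ B

/-- `X` is the directed union of the sets `B i`, and every element of the group `Γ` of bijections
of `X` is supported on some `B i`. -/
structure IsBoundedlySupported {X : Type v} {I : Type w} (B : I → Set X)
    (Γ : Subgroup (Equiv.Perm X)) : Prop where
  directed : Directed (· ⊆ ·) B
  iUnion_eq : ⋃ i, B i = Set.univ
  supported : ∀ g ∈ Γ, ∃ i, SupportedOn g (B i)

/-- `t` is a dissipator for the group `Γ` of bijections of `X` and the set `B`. In the last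
field, `φ` is the bijection that equals `t ^ p * g * (t ^ p)⁻¹` on `t ^ p (B)` for every `p ≥ 1`
and is the identity elsewhere. -/
structure IsDissipator {X : Type v} (Γ : Subgroup (Equiv.Perm X)) (B : Set X)
    (t : Equiv.Perm X) : Prop where
  mem : t ∈ Γ
  displaces : ∀ p : ℕ, 1 ≤ p → ((t ^ p : Equiv.Perm X) '' B) ∩ B = ∅
  exists_mem : ∀ g ∈ Γ, SupportedOn g B → ∃ φ ∈ Γ,
    (∀ p : ℕ, 1 ≤ p → ∀ x ∈ (t ^ p : Equiv.Perm X) '' B, φ x = (t ^ p * g * (t ^ p)⁻¹) x) ∧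
    ∀ x, (∀ p : ℕ, 1 ≤ p → x ∉ (t ^ p : Equiv.Perm X) '' B) → φ x = x

/-- A group is dissipated if it is isomorphic to a boundedly supported group of bijections of
some set that has a dissipator for every bounded set. -/
def IsDissipated (G : Type u) [Group G] : Prop :=
  ∃ (X : Type v) (I : Type w) (B : I → Set X) (Γ : Subgroup (Equiv.Perm X)),
    Nonempty (G ≃* Γ) ∧ IsBoundedlySupported B Γ ∧ ∀ i, ∃ t, IsDissipator Γ (B i) t

/-! Existence follows Hall: iterate Cayley's embedding of a finite group into the symmetric group on
its elements and take the union. Two embeddings of `G` into one level make `G` act freely on that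
level by left translation; free actions on the same finite set are isomorphic, so the embeddings
become conjugate one level up (`exists_perm_intertwining`).

In any Hall group, embedding `H × H` and conjugating yields a commuting copy of a finite subgroup
`H` (`exists_commuting_copy`); uniqueness of embeddings then gives both positive properties.
Dissipation fails because of torsion: a power `t ^ n = 1` cannot move a nonempty set off itself. -/

/-! ### Conjugacy of semiregular permutation representations -/

/-- A free action of `G` on `X` is isomorphic to the action of `G` on a disjoint union of copies
of `G` by left translation. -/
theorem exists_prod_equiv_of_free_smul (G : Type u) (X : Type v) [Group G] [MulAction G X]
    (free : ∀ (a b : G) (x : X), a • x = b • x → a = b) :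
    ∃ (Q : Type v) (e : G × Q ≃ X), ∀ (a b : G) (q : Q), e (a * b, q) = a • e (b, q) := by
  -- Every point is a translate of the chosen representative of its orbit, by a unique element since
  -- the action is free.
  let F : G × MulAction.orbitRel.Quotient G X → X := fun p => p.1 • p.2.out
  have hF : Function.Bijective F := by
    constructor
    · rintro ⟨a, p⟩ ⟨b, q⟩ h
      have h' : a • p.out = b • q.out := h
      have hpq : p = q := by
        rw [← Quotient.out_eq p, ← Quotient.out_eq q]
        refine Quotient.sound (MulAction.orbitRel_apply.2 ⟨a⁻¹ * b, ?_⟩)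
        change (a⁻¹ * b) • q.out = p.out
        rw [mul_smul, ← h', inv_smul_smul]
      subst hpq
      rw [free a b _ h']
    · intro x
      obtain ⟨a, ha⟩ := MulAction.orbitRel_apply.1
        (Quotient.exact (Quotient.out_eq (Quotient.mk (MulAction.orbitRel G X) x)))
      refine ⟨(a⁻¹, Quotient.mk _ x), ?_⟩
      change a⁻¹ • _ = x
      rw [← ha]
      exact inv_smul_smul a x
  exact ⟨_, Equiv.ofBijective F hF, fun a b q => mul_smul a b q.out⟩

/-- Any two embeddings of a group `G` into a finite group `T` become conjugate after composition
with the left regular representation of `T`. -/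
theorem exists_perm_intertwining {G : Type u} {T : Type v} [Group G] [Group T] [Finite T]
    (φ ψ : G →* T) (hφ : Function.Injective φ) (hψ : Function.Injective ψ) :
    ∃ σ : Equiv.Perm T, ∀ a x, σ (φ a * x) = ψ a * σ x := by
  have key : ∀ χ : G →* T, Function.Injective χ → ∃ (Q : Type v) (e : G × Q ≃ T),
      ∀ (a b : G) (q : Q), e (a * b, q) = χ a * e (b, q) := by
    intro χ hχ
    let _ : MulAction G T := MulAction.compHom T χ
    exact exists_prod_equiv_of_free_smul G T fun a b x h => hχ (mul_right_cancel h)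
  obtain ⟨P, e, he⟩ := key φ hφ
  obtain ⟨Q, e', he'⟩ := key ψ hψ
  have : Finite G := Finite.of_injective φ hφ
  have : Finite P := Finite.of_injective (fun q => e (1, q)) fun p q h => by simpa using h
  have : Finite Q := Finite.of_injective (fun q => e' (1, q)) fun p q h => by simpa using h
  -- Both actions have `|T| / |G|` orbits, so the orbits can be matched.
  have hcard : Nat.card P = Nat.card Q := by
    have h := (Nat.card_congr e).trans (Nat.card_congr e').symm
    rw [Nat.card_prod, Nat.card_prod] at h
    exact Nat.eq_of_mul_eq_mul_left Nat.card_pos h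
  let c : P ≃ Q := Classical.choice (Finite.card_eq.1 hcard)
  refine ⟨e.symm.trans ((Equiv.prodCongr (Equiv.refl G) c).trans e'), fun a x => ?_⟩
  obtain ⟨⟨b, q⟩, rfl⟩ := e.surjective x
  simp [← he, he']

/-! ### The tower of symmetric groups and its direct limit -/

/-- The tower of groups that starts with the symmetric group on three letters, in which every group
is followed by the symmetric group on its underlying set. -/
def symmTower : ℕ → GrpCat.{u}
  | 0 => GrpCat.of (ULift.{u} (Equiv.Perm (Fin 3)))
  | n + 1 => GrpCat.of (Equiv.Perm (symmTower n))

instance finite_symmTower : ∀ n, Finite (symmTower.{u} n)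
  | 0 => inferInstanceAs (Finite (ULift.{u} (Equiv.Perm (Fin 3))))
  | n + 1 =>
    haveI := finite_symmTower n
    inferInstanceAs (Finite (Equiv.Perm (symmTower n)))

/-- The bound `k < k!` needs `k ≥ 3`, hence the start at three letters: from two letters, the orders
would stay at 2. -/
theorem add_three_le_card_symmTower (n : ℕ) : n + 3 ≤ Nat.card (symmTower.{u} n) := by
  induction n with
  | zero =>
    change 0 + 3 ≤ Nat.card (ULift.{u} (Equiv.Perm (Fin 3)))
    rw [Nat.card_ulift, Nat.card_perm, Nat.card_fin]
    decide
  | succ n ih =>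
    change n + 1 + 3 ≤ Nat.card (Equiv.Perm (symmTower.{u} n))
    rw [Nat.card_perm]
    have := Nat.lt_factorial_self (n := Nat.card (symmTower.{u} n)) (by omega)
    omega

/-- The left regular representation of a group of the tower, as a map to the next group. -/
def symmTowerStep (n : ℕ) : symmTower.{u} n →* symmTower.{u} (n + 1) :=
  MulAction.toPermHom (symmTower n) (symmTower n)

theorem symmTowerStep_injective (n : ℕ) : Function.Injective (symmTowerStep.{u} n) :=
  MulAction.toPerm_injective

/-- The transition maps of the tower of symmetric groups. -/
def symmTowerMap (m n : ℕ) (h : m ≤ n) : symmTower.{u} m →* symmTower.{u} n :=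
  Nat.leRecOn (C := fun k => symmTower.{u} m →* symmTower.{u} k) h
    (fun {k} g => (symmTowerStep k).comp g) (MonoidHom.id _)

theorem symmTowerMap_self (m : ℕ) : symmTowerMap.{u} m m le_rfl = MonoidHom.id _ :=
  Nat.leRecOn_self _

theorem symmTowerMap_succ {m n : ℕ} (h : m ≤ n) :
    symmTowerMap.{u} m (n + 1) (h.trans n.le_succ) = (symmTowerStep n).comp (symmTowerMap m n h) :=
  Nat.leRecOn_succ h _

theorem symmTowerMap_injective {m n : ℕ} (h : m ≤ n) :
    Function.Injective (symmTowerMap.{u} m n h) := by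
  induction n, h using Nat.le_induction with
  | base => rw [symmTowerMap_self]; exact Function.injective_id
  | succ n h ih => rw [symmTowerMap_succ h]; exact (symmTowerStep_injective n).comp ih

theorem symmTowerMap_comp {l m n : ℕ} (h : l ≤ m) (h' : m ≤ n) :
    (symmTowerMap.{u} m n h').comp (symmTowerMap l m h) = symmTowerMap l n (h.trans h') := by
  induction n, h' using Nat.le_induction with
  | base => rw [symmTowerMap_self]; rfl
  | succ n h' ih => rw [symmTowerMap_succ h', symmTowerMap_succ (h.trans h'), ← ih]; rfl

instance directedSystem_symmTower :
    DirectedSystem (fun n => symmTower.{u} n) (symmTowerMap.{u} · · ·) where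
  map_self _ x := DFunLike.congr_fun (symmTowerMap_self _) x
  map_map _ _ _ h h' x := DFunLike.congr_fun (symmTowerMap_comp h h') x

/-- The direct limit of the tower of symmetric groups. -/
abbrev HallGroup : Type u :=
  DirectLimit (fun n => symmTower.{u} n) symmTowerMap.{u}

namespace HallGroup

/-- The canonical map from a group of the tower to the direct limit. -/
noncomputable def of (n : ℕ) : symmTower.{u} n →* HallGroup.{u} where
  toFun x := ⟦⟨n, x⟩⟧
  map_one' := (DirectLimit.one_def (G := fun n => symmTower.{u} n) (f := symmTowerMap.{u}) n).symm
  map_mul' x y := (DirectLimit.mul_def (G := fun n => symmTower.{u} n) (f := symmTowerMap.{u}) n x y).symm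

theorem of_injective (n : ℕ) : Function.Injective (of.{u} n) :=
  DirectLimit.mk_injective (F := fun n => symmTower.{u} n) symmTowerMap.{u} (fun _ _ h => symmTowerMap_injective h) n

theorem of_map {m n : ℕ} (h : m ≤ n) (x : symmTower.{u} m) :
    of n (symmTowerMap m n h x) = of m x :=
  DirectLimit.mk_apply (F := fun n => symmTower.{u} n) (f := symmTowerMap.{u}) m n x h

theorem of_step (n : ℕ) (x : symmTower.{u} n) : of (n + 1) (symmTowerStep n x) = of n x := by
  rw [← of_map n.le_succ x, symmTowerMap_succ le_rfl, symmTowerMap_self]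
  rfl

theorem range_of_mono : Monotone fun n => (of.{u} n).range := by
  rintro m n h _ ⟨x, rfl⟩
  exact ⟨symmTowerMap m n h x, of_map h x⟩

theorem exists_mem_range_of (z : HallGroup.{u}) : ∃ n, z ∈ (of.{u} n).range := by
  obtain ⟨n, x, rfl⟩ := DirectLimit.exists_eq_mk symmTowerMap.{u} z
  exact ⟨n, x, rfl⟩

theorem exists_subset_range_of {S : Set HallGroup.{u}} (hS : S.Finite) :
    ∃ n, S ⊆ (of.{u} n).range := by
  choose N hN using exists_mem_range_of.{u}
  obtain ⟨n, hn⟩ := (hS.image N).bddAbove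
  exact ⟨n, fun z hz => range_of_mono (hn (Set.mem_image_of_mem N hz)) (hN z)⟩

theorem exists_lift {G : Type v} [Group G] {n : ℕ} (f : G →* HallGroup.{u})
    (hf : Set.range f ⊆ (of.{u} n).range) : ∃ f' : G →* symmTower.{u} n, ∀ x, of n (f' x) = f x := by
  choose F hF using fun x => hf (Set.mem_range_self x)
  exact ⟨MonoidHom.mk' F fun x y => of_injective n (by simp [hF]), hF⟩

theorem countable : Countable HallGroup.{u} := by
  refine Function.Surjective.countable (f := fun p : Σ n, symmTower.{u} n => of p.1 p.2) fun z => ?_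
  obtain ⟨n, x, rfl⟩ := exists_mem_range_of z
  exact ⟨⟨n, x⟩, rfl⟩

theorem locallyFinite : IsLocallyFiniteGroup HallGroup.{u} := by
  rintro H ⟨S, rfl⟩
  obtain ⟨n, hn⟩ := exists_subset_range_of S.finite_toSet
  have hfin : ((of.{u} n).range : Set HallGroup.{u}).Finite := Set.finite_range _
  exact (hfin.subset ((Subgroup.closure_le _).2 hn)).to_subtype

/-- Cayley's theorem, with the regular representation of `G` carried to a level large enough to
contain `G` as a set. -/
theorem exists_embedding (G : Type v) [Group G] [Finite G] :
    ∃ f : G →* HallGroup.{u}, Function.Injective f := by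
  set n := Nat.card G
  have hle : Nat.card G ≤ Nat.card (symmTower.{u} n) :=
    le_trans (by omega) (add_three_le_card_symmTower n)
  obtain ⟨ι⟩ : Nonempty (G ↪ symmTower.{u} n) := by
    have := Fintype.ofFinite G
    have := Fintype.ofFinite (symmTower.{u} n)
    rw [Nat.card_eq_fintype_card, Nat.card_eq_fintype_card] at hle
    exact Function.Embedding.nonempty_of_card_le hle
  let g : G →* symmTower.{u} (n + 1) :=
    (Equiv.Perm.viaEmbeddingHom ι).comp (MulAction.toPermHom G G)
  have hg : Function.Injective g :=
    (Equiv.Perm.viaEmbeddingHom_injective ι).comp MulAction.toPerm_injective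
  exact ⟨(of (n + 1)).comp g, (of_injective (n + 1)).comp hg⟩

theorem embedding_unique (G : Type v) [Group G] [Finite G] (f g : G →* HallGroup.{u})
    (hf : Function.Injective f) (hg : Function.Injective g) :
    ∃ s : HallGroup.{u}, ∀ x, g x = s * f x * s⁻¹ := by
  obtain ⟨n, hn⟩ := exists_subset_range_of ((Set.finite_range f).union (Set.finite_range g))
  obtain ⟨f', hf'⟩ := exists_lift f (Set.subset_union_left.trans hn)
  obtain ⟨g', hg'⟩ := exists_lift g (Set.subset_union_right.trans hn)
  obtain ⟨σ, hσ⟩ := exists_perm_intertwining f' g'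
    (fun x y h => hf (by rw [← hf', h, hf'])) (fun x y h => hg (by rw [← hg', h, hg']))
  -- A permutation of level `n` is an element of level `n + 1`, where level `n` sits as left
  -- translations; intertwining thus becomes conjugation.
  let τ : symmTower.{u} (n + 1) := σ
  have hτ (x : G) : symmTowerStep n (g' x) * τ = τ * symmTowerStep n (f' x) :=
    Equiv.ext fun y => (hσ x y).symm
  refine ⟨of (n + 1) τ, fun x => ?_⟩
  rw [eq_mul_inv_iff_mul_eq, ← hf', ← hg', ← of_step n (g' x), ← of_step n (f' x), ← map_mul, ← map_mul, hτ]

theorem isHallUniversal : IsHallUniversal HallGroup.{u} :=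
  ⟨countable, locallyFinite, fun G => exists_embedding G, fun G => embedding_unique G⟩

end HallGroup

/-! ### Properties of Hall's group -/

namespace IsHallUniversal

variable {U : Type u} [Group U]

/-- Every finite subgroup has a copy that meets it trivially and commutes with it. -/
theorem exists_commuting_copy (hU : IsHallUniversal U) (H : Subgroup U) [Finite H] :
    ∃ f : H →* U, Function.Injective f ∧ (∀ h k : H, Commute (h : U) (f k)) ∧
      ∀ h : H, (h : U) * f h = 1 → h = 1 := by
  obtain ⟨j, hj⟩ := hU.exists_embedding (H × H)
  -- Conjugation by `s` turns the first factor into `H` itself; the second factor is the copy, and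
  -- `h * f h` is the image of `(h, h)`.
  obtain ⟨s, hs⟩ := hU.embedding_unique H (j.comp (MonoidHom.inl H H)) H.subtype
    (hj.comp (Prod.mk_left_injective 1)) H.subtype_injective
  replace hs (h : H) : (h : U) = MulAut.conj s (j (h, 1)) := hs h
  have hinj : Function.Injective fun p => MulAut.conj s (j p) := (MulAut.conj s).injective.comp hj
  refine ⟨(MulAut.conj s).toMonoidHom.comp (j.comp (MonoidHom.inr H H)),
    hinj.comp (Prod.mk_right_injective 1), fun h k => ?_, fun h hh => ?_⟩
  · rw [hs h]
    exact (((MonoidHom.commute_inl_inr h k).map j).map (MulAut.conj s))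
  · have h1 : MulAut.conj s (j (h, h)) = MulAut.conj s (j 1) := by
      rw [map_one, map_one, ← hh, hs h]
      change _ = MulAut.conj s (j (h, 1)) * MulAut.conj s (j (1, h))
      rw [← map_mul, ← map_mul, Prod.mk_mul_mk, mul_one, one_mul]
    exact congrArg Prod.fst (hinj h1)

theorem isBinate (hU : IsHallUniversal U) : IsBinate U := by
  intro H hH
  have := hU.locallyFinite H hH
  obtain ⟨f, hf, hcomm, htriv⟩ := hU.exists_commuting_copy H
  -- The diagonal `h ↦ h * f h` is a homomorphism because the factors commute; being injective, it
  -- is conjugate to `f`.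
  let d : H →* U := H.subtype.noncommCoprod f hcomm |>.comp ((MonoidHom.id H).prod (MonoidHom.id H))
  have hd : Function.Injective d := (injective_iff_map_eq_one d).2 htriv
  obtain ⟨t, ht⟩ := hU.embedding_unique H f d hf hd
  exact ⟨f, hcomm, t, fun h => (ht h).symm⟩

theorem hasCommutingConjugates (hU : IsHallUniversal U) : HasCommutingConjugates U := by
  intro H hH
  have := hU.locallyFinite H hH
  obtain ⟨f, hf, hcomm, -⟩ := hU.exists_commuting_copy H
  obtain ⟨t, ht⟩ := hU.embedding_unique H H.subtype f H.subtype_injective hf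
  refine ⟨t, fun h hh k hk => ?_⟩
  have := hcomm ⟨h, hh⟩ ⟨k, hk⟩
  rwa [ht] at this

theorem nontrivial (hU : IsHallUniversal U) : Nontrivial U := by
  obtain ⟨f, hf⟩ := hU.exists_embedding (ULift.{u} (Equiv.Perm (Fin 2)))
  exact hf.nontrivial

end IsHallUniversal

/-! ### Torsion as an obstruction to dissipation -/

theorem IsLocallyFiniteGroup.isOfFinOrder {Γ : Type u} [Group Γ] (h : IsLocallyFiniteGroup Γ)
    (t : Γ) : IsOfFinOrder t := by
  have := h (Subgroup.zpowers t) ⟨{t}, by simp [Subgroup.zpowers_eq_closure]⟩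
  exact isOfFinOrder_iff_pow_eq_one.2 <| by
    obtain ⟨n, hn, hn'⟩ := isOfFinOrder_iff_pow_eq_one.1
      (isOfFinOrder_of_finite (⟨t, Subgroup.mem_zpowers t⟩ : Subgroup.zpowers t))
    exact ⟨n, hn, congrArg Subtype.val hn'⟩

/-- A dissipator of finite order can only dissipate the empty set. -/
theorem IsDissipator.eq_empty {X : Type v} {Γ : Subgroup (Equiv.Perm X)} {B : Set X}
    {t : Equiv.Perm X} (h : IsDissipator Γ B t) (ht : IsOfFinOrder t) : B = ∅ := by
  obtain ⟨n, hn, hn'⟩ := isOfFinOrder_iff_pow_eq_one.1 ht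
  -- For `p = n` the displaced set is `B` itself, so `B ∩ B = ∅`.
  simpa [hn'] using h.displaces n hn

theorem IsLocallyFiniteGroup.not_isDissipated {Γ : Type u} [Group Γ] [Nontrivial Γ]
    (h : IsLocallyFiniteGroup Γ) : ¬ IsDissipated.{u, v, w} Γ := by
  rintro ⟨X, I, B, Δ, ⟨e⟩, hB, hdiss⟩
  have hempty (i : I) : B i = ∅ := by
    obtain ⟨t, ht⟩ := hdiss i
    refine ht.eq_empty ?_
    have hfin := (h.isOfFinOrder (e.symm ⟨t, ht.mem⟩))
    simpa using (Δ.subtype.comp e.toMonoidHom).isOfFinOrder hfin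
  have : IsEmpty X := by
    rw [← Set.univ_eq_empty_iff, ← hB.iUnion_eq, Set.iUnion_eq_empty]
    exact hempty
  -- Permutations of an empty set form a trivial group.
  exact not_subsingleton Γ e.toEquiv.subsingleton

theorem mainTheorem6 :
    (∃ (U : Type u) (_ : Group U), IsHallUniversal U) ∧
      ∀ (U : Type u) [Group U], IsHallUniversal U →
        IsBinate U ∧ HasCommutingConjugates U ∧ ¬ IsDissipated.{u, v, w} U := by
  refine ⟨⟨HallGroup, inferInstance, HallGroup.isHallUniversal⟩, fun U _ hU => ?_⟩
  have := hU.nontrivial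
  exact ⟨hU.isBinate, hU.hasCommutingConjugates, hU.locallyFinite.not_isDissipated⟩
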